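/- Setting. A server holds $N\ge 1$ files of $F$ bits each (independent and uniformly distributed) and is connected to $K\ge 1$ users through an error-free shared link; each user has a cache of $MF$ bits, $M\in[0,N]$. In a caching scheme, the cache of each user is filled with an arbitrary function of the files, not depending on the requests; then the users request files $d_1,\dots,d_K\in\{1,\dots,N\}$, the server sends to all users a message of $RF$ bits that depends arbitrarily on the files and the requests, and user $k$ reconstructs file $d_k$ from its cache, the message and the requests. (Schemes may be randomized independently of the files; $MF$ and $RF$ are rounded down.) A rate $R\ge 0$ is achievable if for every $\varepsilon>0$ and all sufficiently large $F$ there is a scheme for which, for every request vector, each user errs with probability at most $\varepsilon$. The optimal centralized rate $R^\star(M)$ is the infimum of the achievable rates. Decentralized algorithm. Placement: independently for all $k$ and $n$, user $k$ caches a uniformly random subset of $\lfloor MF/N\rfloor$ bits of file $n$. Delivery: the server uses the shorter of two procedures. (1) For each nonempty $\mathcal S\subseteq\{1,\dots,K\}$ it sends $\bigoplus_{k\in\mathcal S}V_{k,\mathcal S\setminus\{k\}}$, where $V_{k,\mathcal T}$ is the string of the bits of file $d_k$ cached at every user in $\mathcal T$ and at no user outside $\mathcal T$, and the strings are zero-padded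 to the length of the longest. (2) For each file $n$ it sends just enough random linear combinations over $\mathbb F_2$ of the bits of file $n$ for all users requesting file $n$ to decode it. The rate $R_D(M)$ of the algorithm is the infimum of all $R\ge0$ such that, for every request vector, the number of bits sent is at most $RF$ with probability tending to one as $F\to\infty$. Its closed-form expression is \[ \widehat R_D(M)=K\,(1-M/N)\,\min\Bigl\{\frac{N}{KM}\bigl(1-(1-M/N)^K\bigr),\ \frac NK\Bigr\}\quad (0<M\le N),\qquad \widehat R_D(0)=\min\{N,K\}. \] Theorem 2. For any number of files $N\ge1$, any number of users $K\ge1$ and any $M\in[0,N]$, the rate of the decentralized algorithm is within a factor $12$ of the rate of the optimal centralized scheme: \[ R_D(M)\le 12\,R^\star(M)\qquad\text{and}\qquad \widehat R_D(M)\le 12\,R^\star(M). \] For $M<N$ moreover $R^\star(M)>0$, so that \[ \frac{R_D(M)}{R^\star(M)}\le 12\qquad\text{and}\qquad\frac{\widehat R_D(M)}{R^\star(M)}\le 12 . \] -/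

import Mathlib

open MeasureTheory ProbabilityTheory Filter
open scoped Topology ENNReal

noncomputable section

namespace CodedCaching

/-- Bit strings of length `n`. A file of size `F` bits is a `BitString F`. -/
abbrev BitString (n : ℕ) : Type := Fin n → ZMod 2

/-! ### Arbitrary (centralized) caching schemes and the optimal rate -/

/-- A caching scheme for `N` files of `F` bits and `K` users whose caches hold `c` bits each, and
whose shared-link message has `b` bits. All maps are arbitrary functions; the cache contents do not
depend on the requests. -/
structure CachingScheme (N K F c b : ℕ) where
  /-- the cache content of each user, as a function of the files -/
  place : Fin K → (Fin N → BitString F) → BitString c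
  /-- the message sent by the server, as a function of the requests and of the files -/
  deliver : (Fin K → Fin N) → (Fin N → BitString F) → BitString b
  /-- the reconstruction of its requested file by each user, from the requests, its own cache and
  the message -/
  decode : (Fin K → Fin N) → Fin K → BitString c → BitString b → BitString F

/-- The file that user `k` reconstructs for the request vector `d`, when the files are `W`. -/
def CachingScheme.output {N K F c b : ℕ} (s : CachingScheme N K F c b)
    (d : Fin K → Fin N) (k : Fin K) (W : Fin N → BitString F) : BitString F :=
  s.decode d k (s.place k W) (s.deliver d W)

/-- The probability, over independent uniformly distributed files, that user `k` fails to recover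
the file `d k`. -/
def CachingScheme.errorProb {N K F c b : ℕ} (s : CachingScheme N K F c b)
    (d : Fin K → Fin N) (k : Fin K) : ℝ≥0∞ :=
  uniformOn (Set.univ : Set (Fin N → BitString F)) {W | s.output d k W ≠ W (d k)}

/-- `Achievable N K M R`: with caches of `M F` bits and messages of `R F` bits, every user recovers
its requested file with probability arbitrarily close to one, for every request vector, once the
file size `F` is large enough. Schemes may be randomized: `p` is the law of the scheme in use,
which is drawn independently of the files (a point mass is a deterministic scheme). -/
def Achievable (N K : ℕ) (M R : ℝ) : Prop :=
  0 ≤ R ∧ ∀ ε : ℝ≥0∞, 0 < ε → ∀ᶠ F : ℕ in atTop,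
    ∃ p : PMF (CachingScheme N K F ⌊M * F⌋₊ ⌊R * F⌋₊),
      ∀ (d : Fin K → Fin N) (k : Fin K), ∑' s, p s * s.errorProb d k ≤ ε

/-- The optimal worst-case rate `R⋆(M)` over all caching schemes. -/
def optimalRate (N K : ℕ) (M : ℝ) : ℝ := sInf {R : ℝ | Achievable N K M R}

/-! ### The decentralized coded caching algorithm -/

/-- The number of bits of each file that each user caches. -/
def cachedBits (N F : ℕ) (M : ℝ) : ℕ := ⌊M * F / N⌋₊

/-- An uncoded placement: `C k n` is the set of positions of the bits of file `n` that user `k`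
caches. -/
abbrev Placement (N K F : ℕ) : Type := Fin K → Fin N → Finset (Fin F)

/-- The law of the random placement: for all `k` and `n`, independently, the set `C k n` is
uniformly distributed among the sets of `cachedBits N F M` positions. -/
def placementLaw (N K F : ℕ) (M : ℝ) : Measure (Placement N K F) :=
  uniformOn {C : Placement N K F | ∀ k n, (C k n).card = cachedBits N F M}

/-- The positions of the bits of file `d k` that are cached at every user in `T` and at no user
outside `T`. -/
def exclusiveBits {N K F : ℕ} (C : Placement N K F) (d : Fin K → Fin N) (k : Fin K)
    (T : Finset (Fin K)) : Finset (Fin F) :=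
  {i | ∀ j, i ∈ C j (d k) ↔ j ∈ T}

/-- Number of bits sent by the first delivery procedure: for every nonempty set `S` of users the
server sends the XOR, over `k ∈ S`, of the strings `exclusiveBits C d k (S \ {k})`, zero-padded to
the length of the longest of them. -/
def deliveryLength₁ {N K F : ℕ} (C : Placement N K F) (d : Fin K → Fin N) : ℕ :=
  ∑ S : Finset (Fin K) with S.Nonempty, S.sup fun k => (exclusiveBits C d k (S \ {k})).card

/-- The coefficients `a (n, j)` of the `j`-th random linear combination of the bits of file `n`
(over the field with two elements), for `j = 0, 1, 2, …`. -/
abbrev Coefficients (N F : ℕ) : Type := Fin N × ℕ → BitString F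

/-- All coefficient vectors are independent and uniformly distributed. -/
def coefficientsLaw (N F : ℕ) : Measure (Coefficients N F) :=
  Measure.infinitePi fun _ => uniformOn (Set.univ : Set (BitString F))

/-- A user that has cached the bits of a file in the positions `A` can decode this file from its
first `l` linear combinations with coefficients `a 0, …, a (l - 1)`: two files that agree on what
the user knows are equal. -/
def Decodable {F : ℕ} (A : Finset (Fin F)) (a : ℕ → BitString F) (l : ℕ) : Prop :=
  ∀ w w' : BitString F, (∀ i ∈ A, w i = w' i) →
    (∀ j < l, ∑ i, a j i * w i = ∑ i, a j i * w' i) → w = w'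

/-- Number of random linear combinations of the bits of file `n` that the second delivery procedure
sends: just enough for all users requesting file `n` to decode it (`⊤` if there is no such number,
an event of probability zero). -/
def combinationsSent {N K F : ℕ} (C : Placement N K F) (a : Coefficients N F)
    (d : Fin K → Fin N) (n : Fin N) : ℕ∞ :=
  ⨅ (l : ℕ) (_ : ∀ k, d k = n → Decodable (C k n) (fun j => a (n, j)) l), (l : ℕ∞)

/-- Number of bits sent by the second delivery procedure. -/
def deliveryLength₂ {N K F : ℕ} (C : Placement N K F) (a : Coefficients N F)
    (d : Fin K → Fin N) : ℕ∞ :=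
  ∑ n, combinationsSent C a d n

/-- Number of bits sent by the algorithm: the server uses the shorter delivery procedure. -/
def bitsSent {N K F : ℕ} (ω : Placement N K F × Coefficients N F) (d : Fin K → Fin N) : ℕ∞ :=
  min (deliveryLength₁ ω.1 d : ℕ∞) (deliveryLength₂ ω.1 ω.2 d)

/-- The algorithm has worst-case rate at most `R`: for every request vector, it sends at most `R F`
bits with probability tending to one as the file size `F` tends to infinity. -/
def DecentralizedAchieves (N K : ℕ) (M R : ℝ) : Prop :=
  0 ≤ R ∧ ∀ d : Fin K → Fin N,
    Tendsto (fun F : ℕ => ((placementLaw N K F M).prod (coefficientsLaw N F))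
      {ω | bitsSent ω d ≤ (⌊R * F⌋₊ : ℕ∞)}) atTop (𝓝 1)

/-- The worst-case rate `R_D(M)` of the decentralized coded caching algorithm. -/
def decentralizedRate (N K : ℕ) (M : ℝ) : ℝ := sInf {R : ℝ | DecentralizedAchieves N K M R}

/-- The closed-form expression for the rate of the decentralized coded caching algorithm. -/
def decentralizedRateFormula (N K : ℕ) (M : ℝ) : ℝ :=
  if M = 0 then min (N : ℝ) K
  else K * (1 - M / N) * min (N / (K * M) * (1 - (1 - M / N) ^ K)) (N / K)

end CodedCaching

end

/-!
The optimal rate is bounded below by the cut-set bound, and the rate of the decentralized algorithm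
is bounded above by its closed form; the factor `12` comes from comparing the two bounds.

*Lower bound.* Take `s` users and `L` request vectors under which these users jointly ask for `s L`
different files. Their `s` caches and the `L` messages determine these files, except for an event
whose probability is at most `s L` times the error probability of a single user. If this is below
`1 / 2`, more than half of all tuples of files are determined by `s` caches, `L` messages and the
remaining files, and counting gives `s L ≤ s M + L R` (`Achievable.cutSet`); no entropy is needed,
and a randomized scheme is first replaced by one good deterministic scheme.

*Comparison.* The closed form is at most `t (1 - M / N)` for some `t ≤ min {N, K, N / M}`
(`exists_decentralizedRateFormula_le`). If `t ≤ 12`, the bound `1 - M / N ≤ R` for `s = 1` suffices.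
If `t ≥ 12`, then `s = ⌊t / 4⌋` and `L = ⌊N / s⌋` give `t ≤ 9 R` (`le_nine_mul_of_cutSet`).

*Upper bound.* For the first delivery procedure, the events that a given bit is cached at exactly
the users of a given set are not positively correlated for distinct bits, since the caches hold a
fixed number of bits. So the number of such bits has variance at most `F`, and Chebyshev's inequality
applies (`placementLaw_real_exclusiveBits_ge_le`); the binomial theorem sums the expectations over
all sets of users (`mul_codedRate`). For the second procedure, a nonzero string vanishing on the `c`
cached bits is annihilated by `F - c + e` random combinations with probability `2 ^ -(F - c + e)`,
and there are fewer than `2 ^ (F - c)` such strings (`coefficientsLaw_not_decodable_le`).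
-/

namespace CodedCaching

/-! ### The cut-set bound -/

theorem card_bitString (n : ℕ) : Fintype.card (BitString n) = 2 ^ n := by simp

/-- Consider `L` request vectors under which the first `s` users jointly request the first `s * L`
files, each of them once. A set of file tuples on which these users always recover their files is
no larger than what `s` caches, `L` messages and the remaining files can tell apart. -/
theorem CachingScheme.card_le_of_forall_output_eq {N K F c b s L : ℕ} (σ : CachingScheme N K F c b)
    (hs : s ≤ K) (hsL : s * L ≤ N) (d : Fin L → Fin K → Fin N)
    (hd : ∀ j (k : Fin s), (d j (Fin.castLE hs k) : ℕ) = j * s + k)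
    (G : Finset (Fin N → BitString F))
    (hG : ∀ W ∈ G, ∀ j (k : Fin s),
      σ.output (d j) (Fin.castLE hs k) W = W (d j (Fin.castLE hs k))) :
    G.card ≤ 2 ^ (s * c + L * b + (N - s * L) * F) := by
  classical
  let f : (Fin N → BitString F) →
      (Fin s → BitString c) × (Fin L → BitString b) × (Fin (N - s * L) → BitString F) :=
    fun W => (fun k => σ.place (Fin.castLE hs k) W, fun j => σ.deliver (d j) W,
      fun i => W ⟨s * L + i, by omega⟩)
  have hinj : Set.InjOn f G := by
    intro W hW W' hW' h
    simp only [f, Prod.mk.injEq, funext_iff] at h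
    obtain ⟨hp, hm, hr⟩ := h
    funext n
    by_cases hn : (n : ℕ) < s * L
    · have hs0 : 0 < s := Nat.pos_of_ne_zero fun h0 => by simp [h0] at hn
      let j : Fin L := ⟨n / s, Nat.div_lt_of_lt_mul hn⟩
      let k : Fin s := ⟨n % s, Nat.mod_lt _ hs0⟩
      have hdn : d j (Fin.castLE hs k) = n := by
        apply Fin.ext
        rw [hd]
        exact Nat.div_add_mod' _ _
      have h1 := hG W hW j k
      have h2 := hG W' hW' j k
      rw [hdn] at h1 h2
      rw [← h1, ← h2]
      simp only [CachingScheme.output]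
      rw [funext (hp k), funext (hm j)]
    · have := hr ⟨n - s * L, by omega⟩
      have e : (⟨s * L + (n - s * L), by omega⟩ : Fin N) = n := Fin.ext (by simp; omega)
      simp only [e] at this
      exact funext this
  calc G.card ≤ (Finset.univ : Finset ((Fin s → BitString c) × (Fin L → BitString b) ×
        (Fin (N - s * L) → BitString F))).card :=
        Finset.card_le_card_of_injOn f (fun _ _ => Finset.mem_univ _) hinj
    _ = 2 ^ (s * c + L * b + (N - s * L) * F) := by
        simp only [Finset.card_univ, Fintype.card_prod, Fintype.card_fun,
          Fintype.card_fin, ZMod.card, ← pow_mul, ← pow_add]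
        congr 1
        ring

/-- If the error probabilities of a randomized scheme are small enough, then some deterministic
scheme has total error probability below `1 / 2`. -/
theorem exists_sum_errorProb_lt {N K F c b : ℕ} {ι : Type*} (I : Finset ι)
    (p : PMF (CachingScheme N K F c b)) (d : ι → Fin K → Fin N) (k : ι → Fin K) (ε : ℝ≥0∞)
    (hε : I.card * ε < 2⁻¹) (h : ∀ d k, ∑' σ, p σ * σ.errorProb d k ≤ ε) :
    ∃ σ : CachingScheme N K F c b, ∑ i ∈ I, σ.errorProb (d i) (k i) < 2⁻¹ := by
  by_contra! hcon
  refine absurd hε (not_lt.2 ?_)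
  calc (2⁻¹ : ℝ≥0∞) = ∑' σ, p σ * 2⁻¹ := by rw [ENNReal.tsum_mul_right, p.tsum_coe, one_mul]
    _ ≤ ∑' σ, p σ * ∑ i ∈ I, σ.errorProb (d i) (k i) :=
        ENNReal.tsum_le_tsum fun σ => by gcongr; exact hcon σ
    _ = ∑' σ, ∑ i ∈ I, p σ * σ.errorProb (d i) (k i) := by simp_rw [Finset.mul_sum]
    _ = ∑ i ∈ I, ∑' σ, p σ * σ.errorProb (d i) (k i) :=
        Summable.tsum_finsetSum fun _ _ => ENNReal.summable
    _ ≤ ∑ i ∈ I, ε := Finset.sum_le_sum fun i _ => h _ _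
    _ = I.card * ε := by simp

/-- The cut-set bound, for the request vectors in which the first `s` users ask for `s` consecutive
files each time. -/
theorem Achievable.cutSet {N K : ℕ} {M R : ℝ} (hM : 0 ≤ M) (h : Achievable N K M R) {s L : ℕ}
    (hs : s ≤ K) (hsL : s * L ≤ N) (hN : 0 < N) :
    (s * L : ℝ) ≤ s * M + L * R := by
  classical
  obtain ⟨hR, h⟩ := h
  -- In the `j`-th request vector the users beyond the first `s` may ask for anything.
  let d : Fin L → Fin K → Fin N := fun j k =>
    if hk : (j * s + k : ℕ) < N then ⟨j * s + k, hk⟩ else ⟨0, hN⟩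
  have hd : ∀ j (k : Fin s), (d j (Fin.castLE hs k) : ℕ) = j * s + k := by
    intro j k
    have : (j * s + k : ℕ) < N := by
      have h1 : (j + 1 : ℕ) * s ≤ L * s := Nat.mul_le_mul_right _ j.2
      have h2 := k.2
      nlinarith
    simp [d, this]
  let ε : ℝ≥0∞ := 2⁻¹ / (s * L + 1 : ℕ)
  have hε0 : 0 < ε := ENNReal.div_pos (by simp) (ENNReal.natCast_ne_top _)
  have hε : ((Finset.univ : Finset (Fin L × Fin s)).card : ℝ≥0∞) * ε < 2⁻¹ := by
    rw [← mul_div_assoc, ENNReal.div_lt_iff (.inl (by simp)) (.inl (ENNReal.natCast_ne_top _)),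
      mul_comm]
    refine (ENNReal.mul_lt_mul_iff_right (by simp) (by simp)).2 ?_
    rw [Finset.card_univ, Fintype.card_prod, Fintype.card_fin, Fintype.card_fin, Nat.cast_lt]
    linarith [mul_comm L s]
  obtain ⟨F, hF, hF1⟩ := ((h ε hε0).and (eventually_ge_atTop 1)).exists
  obtain ⟨p, hp⟩ := hF
  obtain ⟨σ, hσ⟩ := exists_sum_errorProb_lt (Finset.univ : Finset (Fin L × Fin s)) p
    (fun i => d i.1) (fun i => Fin.castLE hs i.2) ε hε hp
  let G : Finset (Fin N → BitString F) := Finset.univ.filter fun W => ∀ j (k : Fin s),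
      σ.output (d j) (Fin.castLE hs k) W = W (d j (Fin.castLE hs k))
  have hcard := σ.card_le_of_forall_output_eq hs hsL d hd G fun W hW => (Finset.mem_filter.1 hW).2
  -- By the union bound, more than half of all file tuples are decoded without error.
  have hhalf : 2 ^ (N * F) < 2 * G.card := by
    have hbad : uniformOn (Set.univ : Set (Fin N → BitString F)) (↑Gᶜ) < 2⁻¹ := by
      refine lt_of_le_of_lt (le_trans (measure_mono ?_) (measure_biUnion_finset_le Finset.univ
        fun i : Fin L × Fin s => {W | σ.output (d i.1) (Fin.castLE hs i.2) W ≠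
          W (d i.1 (Fin.castLE hs i.2))})) hσ
      intro W hW
      simpa [G] using hW
    rw [uniformOn_univ, Measure.count_apply_finset] at hbad
    have hc : Fintype.card (Fin N → BitString F) = 2 ^ (N * F) := by
      rw [Fintype.card_fun, card_bitString, Fintype.card_fin, ← pow_mul, mul_comm]
    have hG' := Finset.card_compl_add_card G
    rw [hc] at hG' hbad
    rw [ENNReal.div_lt_iff (by simp) (by simp), ← ENNReal.div_eq_inv_mul,
      ENNReal.lt_div_iff_mul_lt (by simp) (by simp)] at hbad
    have : Gᶜ.card * 2 < 2 ^ (N * F) := by exact_mod_cast hbad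
    omega
  have hexp : N * F < s * ⌊M * F⌋₊ + L * ⌊R * F⌋₊ + (N - s * L) * F + 1 := by
    rw [← Nat.pow_lt_pow_iff_right (a := 2) (by norm_num), pow_succ]
    omega
  have hsub : s * L * F + (N - s * L) * F = N * F := by
    rw [← add_mul]; congr 1; omega
  have hle : s * L * F ≤ s * ⌊M * F⌋₊ + L * ⌊R * F⌋₊ := by omega
  have hF0 : (0 : ℝ) < F := by exact_mod_cast hF1
  have hle' : (s * L * F : ℝ) ≤ s * ⌊M * F⌋₊ + L * ⌊R * F⌋₊ := by exact_mod_cast hle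
  have h1 : (⌊M * F⌋₊ : ℝ) ≤ M * F := Nat.floor_le (by positivity)
  have h2 : (⌊R * F⌋₊ : ℝ) ≤ R * F := Nat.floor_le (by positivity)
  have h3 : (s * ⌊M * F⌋₊ : ℝ) ≤ s * (M * F) := by gcongr
  have h4 : (L * ⌊R * F⌋₊ : ℝ) ≤ L * (R * F) := by gcongr
  refine le_of_mul_le_mul_right ?_ hF0
  linarith

/-- Sending all files achieves the rate `N`; in particular the set of achievable rates, whose
infimum is the optimal rate, is nonempty. -/
theorem achievable_card_files (N K : ℕ) (M : ℝ) : Achievable N K M N := by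
  classical
  refine ⟨Nat.cast_nonneg _, fun ε hε => Eventually.of_forall fun F => ?_⟩
  have hb : ⌊(N * F : ℝ)⌋₊ = N * F := by exact_mod_cast Nat.floor_natCast (R := ℝ) (N * F)
  rw [hb]
  refine ⟨PMF.pure
    { place := fun _ _ _ => 0
      deliver := fun _ W i => W (finProdFinEquiv.symm i).1 (finProdFinEquiv.symm i).2
      decode := fun d k _ m i => m (finProdFinEquiv (d k, i)) }, fun d k => ?_⟩
  refine le_of_eq_of_le (ENNReal.tsum_eq_zero.2 fun σ => ?_) zero_le
  rw [PMF.pure_apply]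
  split_ifs with hσ
  · subst hσ
    simp [CachingScheme.errorProb, CachingScheme.output]
  · simp

theorem le_optimalRate {N K : ℕ} {M x : ℝ} (h : ∀ R, Achievable N K M R → x ≤ R) :
    x ≤ optimalRate N K M :=
  le_csInf ⟨N, achievable_card_files N K M⟩ h

/-! ### Comparison of the closed-form rate with the cut-set bound -/

/-- The three elementary bounds on the closed-form rate (every user served separately, every file
served separately, and the coded gain `N / M`), combined in one parameter `t`. -/
theorem exists_decentralizedRateFormula_le {N K : ℕ} (hN : 0 < N) (hK : 0 < K) {M : ℝ}
    (hM0 : 0 ≤ M) (hMN : M ≤ N) :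
    ∃ t : ℝ, 0 ≤ t ∧ t ≤ N ∧ t ≤ K ∧ t * M ≤ N ∧
      decentralizedRateFormula N K M ≤ t * (1 - M / N) := by
  have hN' : (0 : ℝ) < N := by exact_mod_cast hN
  have hK' : (0 : ℝ) < K := by exact_mod_cast hK
  rcases hM0.eq_or_lt with rfl | hM
  · refine ⟨min N K, by positivity, min_le_left _ _, min_le_right _ _, by simp, ?_⟩
    simp [decentralizedRateFormula]
  · have hq1 : M / N ≤ 1 := (div_le_one hN').2 hMN
    refine ⟨min (min (N : ℝ) K) (N / M), by positivity, (min_le_left _ _).trans (min_le_left _ _),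
      (min_le_left _ _).trans (min_le_right _ _), ?_, ?_⟩
    · calc min (min (N : ℝ) K) (N / M) * M ≤ N / M * M := by gcongr; exact min_le_right _ _
        _ = N := by field_simp
    · rw [decentralizedRateFormula, if_neg hM.ne', mul_right_comm]
      refine mul_le_mul_of_nonneg_right ?_ (by linarith)
      set A : ℝ := N / (K * M) * (1 - (1 - M / N) ^ K) with hA
      have hpow : 0 ≤ (1 - M / N : ℝ) ^ K := pow_nonneg (by linarith) _
      -- Bernoulli's inequality.
      have hbern : 1 - K * (M / N) ≤ (1 - M / N : ℝ) ^ K := by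
        have := one_add_mul_le_pow (a := -(M / N : ℝ)) (by linarith) K
        rw [← sub_eq_add_neg] at this
        linarith
      refine le_min (le_min ?_ ?_) ?_
      · calc K * min A (N / K) ≤ K * (N / K) := by gcongr; exact min_le_right _ _
          _ = N := by field_simp
      · calc K * min A (N / K) ≤ K * A := by gcongr; exact min_le_left _ _
          _ ≤ K * (N / (K * M) * (K * (M / N))) := by rw [hA]; gcongr; linarith
          _ = K := by field_simp
      · calc K * min A (N / K) ≤ K * A := by gcongr; exact min_le_left _ _
          _ ≤ K * (N / (K * M) * 1) := by rw [hA]; gcongr; linarith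
          _ = N / M := by field_simp

/-- The cut-set bound at `s ≈ t / 4`, where `t` is at most each of `N`, `K` and `N / M`. -/
theorem le_nine_mul_of_cutSet {N K : ℕ} {M R t : ℝ} (hM0 : 0 ≤ M)
    (ht12 : 12 ≤ t) (htN : t ≤ N) (htK : t ≤ K) (htM : t * M ≤ N)
    (hcut : ∀ s L : ℕ, s ≤ K → s * L ≤ N → (s * L : ℝ) ≤ s * M + L * R) :
    t ≤ 9 * R := by
  -- Then `s M ≤ N / 4` and `s ≤ N / 4`, while `s ≥ t / 6` because `t ≥ 12`.
  set s : ℕ := ⌊t / 4⌋₊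
  have hs4 : (s : ℝ) ≤ t / 4 := Nat.floor_le (by linarith)
  have hst : t / 4 - 1 < s := Nat.sub_one_lt_floor _
  have hs0 : (0 : ℝ) < s := by linarith
  have hs0' : 0 < s := by exact_mod_cast hs0
  have hsK : s ≤ K := by
    have : (s : ℝ) ≤ K := by linarith
    exact_mod_cast this
  have hc := hcut s (N / s) hsK (Nat.mul_div_le N s)
  set L : ℕ := N / s
  have hL : (N : ℝ) < s * L + s := by
    have := Nat.lt_mul_div_succ N hs0'
    have h' : (N : ℝ) < ((s * (N / s + 1) : ℕ) : ℝ) := by exact_mod_cast this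
    push_cast at h'
    linarith
  have hsL : 3 / 4 * (N : ℝ) ≤ s * L := by linarith
  have hsM : s * M ≤ N / 4 := by nlinarith
  have hL0 : (0 : ℝ) < L := by
    refine pos_of_mul_pos_right (a := (s : ℝ)) ?_ hs0.le
    linarith
  -- `s M ≤ N / 4` is at most a third of `s L`.
  have h1 : 2 / 3 * (s * L : ℝ) ≤ L * R := by linarith
  have h2 : 2 / 3 * (s : ℝ) ≤ R := by
    refine le_of_mul_le_mul_left ?_ hL0
    linarith
  linarith

/-- The cut-set bound for a single user, who must be able to obtain all `N` files. -/
theorem Achievable.one_sub_le {N K : ℕ} (hN : 0 < N) (hK : 0 < K) {M R : ℝ} (hM0 : 0 ≤ M)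
    (h : Achievable N K M R) : 1 - M / N ≤ R := by
  have hN' : (0 : ℝ) < N := by exact_mod_cast hN
  have := h.cutSet hM0 (s := 1) (L := N) hK (by simp) hN
  push_cast at this
  rw [sub_le_iff_le_add, ← sub_le_iff_le_add', le_div_iff₀ hN']
  linarith

/-- For `t ≤ 12` a single user gives the factor `12`; otherwise `s ≈ t / 4` users give `9`. -/
theorem decentralizedRateFormula_le_twelve_mul {N K : ℕ} (hN : 0 < N) (hK : 0 < K) {M : ℝ}
    (hM0 : 0 ≤ M) (hMN : M ≤ N) :
    decentralizedRateFormula N K M ≤ 12 * optimalRate N K M := by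
  have hN' : (0 : ℝ) < N := by exact_mod_cast hN
  have hq0 : 0 ≤ M / N := by positivity
  have hq1 : M / N ≤ 1 := (div_le_one hN').2 hMN
  obtain ⟨t, ht0, htN, htK, htM, hle⟩ := exists_decentralizedRateFormula_le hN hK hM0 hMN
  refine hle.trans ?_
  rcases le_or_gt t 12 with ht | ht
  · have := le_optimalRate fun R hR => Achievable.one_sub_le hN hK hM0 hR
    nlinarith
  · have : t / 9 ≤ optimalRate N K M := le_optimalRate fun R hR => by
      have := le_nine_mul_of_cutSet hM0 ht.le htN htK htM fun s L hs hsL =>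
        hR.cutSet hM0 hs hsL hN
      linarith
    nlinarith

/-! ### Concentration of the number of occurring events -/

open Classical in
/-- Chebyshev's inequality for the number of events that occur, when distinct events are not
positively correlated. -/
theorem measureReal_card_ge_le {Ω : Type*} [MeasurableSpace Ω] (μ : Measure Ω)
    [IsProbabilityMeasure μ] {F : ℕ} (E : Fin F → Set Ω) (hE : ∀ i, MeasurableSet (E i)) (p : ℝ)
    (h1 : ∀ i, μ.real (E i) = p) (h2 : ∀ i j, i ≠ j → μ.real (E i ∩ E j) ≤ p ^ 2)
    {t : ℝ} (ht : 0 < t) :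
    μ.real {ω | F * p + t ≤ (Finset.univ.filter fun i => ω ∈ E i).card} ≤ F / t ^ 2 := by
  set f : Fin F → Ω → ℝ := fun i => (E i).indicator 1 with hf
  have hfi : ∀ i, Integrable (f i) μ := fun i => (integrable_const (1 : ℝ)).indicator (hE i)
  have hint : ∀ i, ∫ ω, f i ω ∂μ = p := fun i => by
    rw [← h1 i]; exact integral_indicator_one (hE i)
  have hprod : ∀ i j ω, f i ω * f j ω = (E i ∩ E j).indicator 1 ω := fun i j ω => by
    simp only [hf, Set.inter_indicator_one, Pi.mul_apply]
  have hfij : ∀ i j, Integrable (fun ω => f i ω * f j ω) μ := fun i j => by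
    simp_rw [hprod]
    exact (integrable_const (1 : ℝ)).indicator ((hE i).inter (hE j))
  have hexp : ∀ i j ω, (f i ω - p) * (f j ω - p) = f i ω * f j ω - (p * f i ω + p * f j ω) + p ^ 2 :=
    fun i j ω => by ring
  have hlin : ∀ i j, Integrable (fun ω => p * f i ω + p * f j ω) μ := fun i j =>
    ((hfi i).const_mul p).add ((hfi j).const_mul p)
  have hdiff : ∀ i j, Integrable (fun ω => f i ω * f j ω - (p * f i ω + p * f j ω)) μ :=
    fun i j => (hfij i j).sub (hlin i j)
  have hcovi : ∀ i j, Integrable (fun ω => (f i ω - p) * (f j ω - p)) μ := fun i j => by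
    simp_rw [hexp]
    exact (hdiff i j).add (integrable_const _)
  have hcov : ∀ i j, ∫ ω, (f i ω - p) * (f j ω - p) ∂μ = μ.real (E i ∩ E j) - p ^ 2 :=
    fun i j => by
      simp_rw [hexp]
      rw [integral_add (hdiff i j) (integrable_const _), integral_sub (hfij i j) (hlin i j),
        integral_add ((hfi i).const_mul p) ((hfi j).const_mul p),
        integral_const_mul, integral_const_mul, hint, hint]
      simp_rw [hprod]
      rw [integral_indicator_one ((hE i).inter (hE j))]
      simp
      ring
  have hsq : ∀ ω, (∑ i, (f i ω - p)) ^ 2 = ∑ i, ∑ j, (f i ω - p) * (f j ω - p) := fun ω => by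
    rw [sq, Finset.sum_mul_sum]
  have hsqi : Integrable (fun ω => (∑ i, (f i ω - p)) ^ 2) μ := by
    simp_rw [hsq]
    exact integrable_finsetSum _ fun i _ => integrable_finsetSum _ fun j _ => hcovi i j
  have hvar : ∫ ω, (∑ i, (f i ω - p)) ^ 2 ∂μ ≤ F := by
    simp_rw [hsq]
    rw [integral_finsetSum _ fun i _ => integrable_finsetSum _ fun j _ => hcovi i j]
    have : ∀ i, ∫ ω, ∑ j, (f i ω - p) * (f j ω - p) ∂μ ≤ 1 := fun i => by
      rw [integral_finsetSum _ fun j _ => hcovi i j, ← Finset.add_sum_erase _ _ (Finset.mem_univ i)]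
      have hoff : ∑ j ∈ Finset.univ.erase i, ∫ ω, (f i ω - p) * (f j ω - p) ∂μ ≤ 0 :=
        Finset.sum_nonpos fun j hj => by
          rw [hcov]
          linarith [h2 i j (Finset.ne_of_mem_erase hj).symm]
      have hdiag : ∫ ω, (f i ω - p) * (f i ω - p) ∂μ ≤ 1 := by
        rw [hcov]
        have := measureReal_le_one (μ := μ) (s := E i ∩ E i)
        nlinarith [sq_nonneg p]
      linarith
    calc _ ≤ ∑ _i : Fin F, (1 : ℝ) := Finset.sum_le_sum fun i _ => this i
      _ = F := by simp
  have hsum : ∀ ω, ∑ i, (f i ω - p) = (Finset.univ.filter fun i => ω ∈ E i).card - F * p :=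
    fun ω => by
      rw [Finset.sum_sub_distrib]
      simp [hf, Set.indicator_apply]
  rw [le_div_iff₀ (by positivity), mul_comm]
  refine le_trans ?_ ((mul_meas_ge_le_integral_of_nonneg
    (Eventually.of_forall fun ω => sq_nonneg _) hsqi (t ^ 2)).trans hvar)
  refine mul_le_mul_of_nonneg_left (measureReal_mono fun ω hω => ?_) (by positivity)
  simp only [Set.mem_ofPred_eq] at hω ⊢
  rw [hsum]
  exact pow_le_pow_left₀ ht.le (by linarith) 2

/-! ### Uniformly random subsets of a fixed size -/

/-- The law of a uniformly random set of `c` positions. -/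
noncomputable def subsetLaw (F c : ℕ) : Measure (Finset (Fin F)) :=
  uniformOn {A : Finset (Fin F) | A.card = c}

theorem coe_powersetCard_univ (F c : ℕ) :
    ((Finset.univ.powersetCard c : Finset (Finset (Fin F))) : Set (Finset (Fin F))) =
      {A | A.card = c} := by
  ext A; simp [Finset.mem_powersetCard]

theorem isProbabilityMeasure_subsetLaw {F c : ℕ} (hc : c ≤ F) :
    IsProbabilityMeasure (subsetLaw F c) := by
  refine isProbabilityMeasure_uniformOn (Set.toFinite _) ?_
  obtain ⟨A, -, hA⟩ := Finset.exists_subset_card_eq (s := (Finset.univ : Finset (Fin F)))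
    (n := c) (by simpa using hc)
  exact ⟨A, hA⟩

theorem subsetLaw_real_disjoint {F c : ℕ} (B : Finset (Fin F)) :
    (subsetLaw F c).real {A | Disjoint A B} = (F - B.card).choose c / F.choose c := by
  have hset : {A : Finset (Fin F) | Disjoint A B} = (Bᶜ.powerset : Finset (Finset (Fin F))) := by
    ext A
    simp only [Set.mem_ofPred_eq, Finset.mem_coe, Finset.mem_powerset]
    exact Finset.subset_compl_iff_disjoint_right.symm
  have hinter : Finset.univ.powersetCard c ∩ Bᶜ.powerset = Bᶜ.powersetCard c := by
    ext A
    simp [Finset.mem_powersetCard, and_comm]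
  rw [subsetLaw, ← coe_powersetCard_univ, hset, Measure.real, uniformOn_apply_finset, hinter,
    Finset.card_powersetCard, Finset.card_powersetCard, Finset.card_compl]
  simp

theorem subsetLaw_real_notMem {F c : ℕ} (hc : c ≤ F) (i : Fin F) :
    (subsetLaw F c).real {A | i ∉ A} = 1 - (c : ℝ) / F := by
  have hset : {A : Finset (Fin F) | i ∉ A} = {A | Disjoint A {i}} := by ext A; simp
  rw [hset, subsetLaw_real_disjoint]
  obtain ⟨G, rfl⟩ : ∃ G, F = G + 1 := ⟨F - 1, by have := i.2; omega⟩
  have h := Nat.choose_mul_succ_eq G c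
  have h' : ((G.choose c : ℝ) * (G + 1)) = (G + 1).choose c * (G + 1 - c) := by
    have := congrArg (Nat.cast (R := ℝ)) h
    rw [Nat.cast_mul, Nat.cast_mul, Nat.cast_sub hc] at this
    push_cast at this
    exact this
  have hpos : (0 : ℝ) < (G + 1).choose c := by exact_mod_cast Nat.choose_pos hc
  have hG : (0 : ℝ) < G + 1 := by positivity
  simp only [Finset.card_singleton, Nat.add_sub_cancel]
  rw [div_eq_iff hpos.ne']
  push_cast
  field_simp
  linarith

theorem subsetLaw_real_mem {F c : ℕ} (hc : c ≤ F) (i : Fin F) :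
    (subsetLaw F c).real {A | i ∈ A} = (c : ℝ) / F := by
  have := isProbabilityMeasure_subsetLaw hc
  have h := probReal_compl_eq_one_sub (μ := subsetLaw F c) (s := {A | i ∉ A})
    (Set.toFinite _).measurableSet
  rw [subsetLaw_real_notMem hc] at h
  simpa [Set.compl_ofPred] using h

theorem subsetLaw_real_notMem_notMem_le {F c : ℕ} (hc : c ≤ F) {i j : Fin F} (hij : i ≠ j) :
    (subsetLaw F c).real ({A | i ∉ A} ∩ {A | j ∉ A}) ≤ (1 - (c : ℝ) / F) ^ 2 := by
  have hset : {A : Finset (Fin F) | i ∉ A} ∩ {A | j ∉ A} = {A | Disjoint A {i, j}} := by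
    ext A; simp
  rw [hset, subsetLaw_real_disjoint, Finset.card_pair hij]
  obtain ⟨G, rfl⟩ : ∃ G, F = G + 2 := ⟨F - 2, by
    have := i.2; have := j.2; have : (i : ℕ) ≠ j := fun h => hij (Fin.ext h); omega⟩
  rw [Nat.add_sub_cancel]
  have hpos : (0 : ℝ) < (G + 2).choose c := by exact_mod_cast Nat.choose_pos hc
  rcases hc.eq_or_lt with rfl | hc'
  · rw [Nat.choose_eq_zero_of_lt (by omega)]
    simp [sq_nonneg]
  have cast : ∀ H : ℕ, c ≤ H + 1 →
      ((H.choose c : ℝ) * (H + 1)) = (H + 1).choose c * (H + 1 - c) := fun H hH => by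
    have := congrArg (Nat.cast (R := ℝ)) (Nat.choose_mul_succ_eq H c)
    rw [Nat.cast_mul, Nat.cast_mul, Nat.cast_sub hH] at this
    push_cast at this
    exact this
  have e1 := cast G (by omega)
  have e2 := cast (G + 1) (by omega)
  push_cast at e2
  have hcG : (c : ℝ) ≤ G + 1 := by exact_mod_cast (by omega : c ≤ G + 1)
  have hG1 : (0 : ℝ) < G + 1 := by positivity
  have hG2 : (0 : ℝ) < G + 2 := by positivity
  have e3 : (G.choose c : ℝ) = (G + 2).choose c * ((G + 2 - c) / (G + 2) * ((G + 1 - c) / (G + 1))) := by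
    have a1 : (G.choose c : ℝ) = (G + 1).choose c * ((G + 1 - c) / (G + 1)) := by
      field_simp; linarith
    have a2 : ((G + 1).choose c : ℝ) = (G + 2).choose c * ((G + 2 - c) / (G + 2)) := by
      field_simp; linarith
    rw [a1, a2]; ring
  rw [e3, mul_div_cancel_left₀ _ hpos.ne', sq]
  push_cast
  have hq : 1 - (c : ℝ) / (G + 2) = (G + 2 - c) / (G + 2) := by field_simp
  rw [hq]
  refine mul_le_mul_of_nonneg_left ?_ (div_nonneg (by linarith) hG2.le)
  rw [div_le_div_iff₀ hG1 hG2]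
  nlinarith [Nat.cast_nonneg (α := ℝ) c]

/-- Inclusion–exclusion reduces this to `subsetLaw_real_notMem_notMem_le`. -/
theorem subsetLaw_real_mem_mem_le {F c : ℕ} (hc : c ≤ F) {i j : Fin F} (hij : i ≠ j) :
    (subsetLaw F c).real ({A | i ∈ A} ∩ {A | j ∈ A}) ≤ ((c : ℝ) / F) ^ 2 := by
  have := isProbabilityMeasure_subsetLaw hc
  have hmeas : ∀ s : Set (Finset (Fin F)), MeasurableSet s := fun s => (Set.toFinite s).measurableSet
  have h1 := measureReal_union_add_inter (μ := subsetLaw F c) (s := {A | i ∉ A})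
    (t := {A | j ∉ A}) (hmeas _)
  have h2 := probReal_compl_eq_one_sub (μ := subsetLaw F c) (s := {A | i ∉ A} ∪ {A | j ∉ A})
    (hmeas _)
  have h3 : ({A : Finset (Fin F) | i ∉ A} ∪ {A | j ∉ A})ᶜ = {A | i ∈ A} ∩ {A | j ∈ A} := by
    ext A; simp
  rw [h3] at h2
  rw [subsetLaw_real_notMem hc, subsetLaw_real_notMem hc] at h1
  have h4 := subsetLaw_real_notMem_notMem_le hc hij
  nlinarith

/-! ### The random placement -/

theorem placementLaw_eq_pi (N K F : ℕ) (M : ℝ) :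
    placementLaw N K F M =
      Measure.pi fun _ => Measure.pi fun _ => subsetLaw F (cachedBits N F M) := by
  have hset : {C : Placement N K F | ∀ k n, (C k n).card = cachedBits N F M} =
      Set.univ.pi fun _ => Set.univ.pi fun _ => {A : Finset (Fin F) | A.card = cachedBits N F M} := by
    ext C; simp
  rw [placementLaw, hset, uniformOn_pi]
  simp_rw [uniformOn_pi]
  rfl

theorem cachedBits_le {N F : ℕ} (hN : 0 < N) {M : ℝ} (hM : M ≤ N) : cachedBits N F M ≤ F := by
  have hN' : (0 : ℝ) < N := by exact_mod_cast hN
  refine Nat.floor_le_of_le ?_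
  rw [div_le_iff₀ hN', mul_comm]
  gcongr

theorem isProbabilityMeasure_placementLaw {N K F : ℕ} (hN : 0 < N) {M : ℝ} (hM : M ≤ N) :
    IsProbabilityMeasure (placementLaw N K F M) := by
  have := isProbabilityMeasure_subsetLaw (cachedBits_le (F := F) hN hM)
  rw [placementLaw_eq_pi]
  infer_instance

theorem placementLaw_real_forall_mem {N K F : ℕ} (hN : 0 < N) {M : ℝ} (hM : M ≤ N) (n : Fin N)
    (G : Fin K → Set (Finset (Fin F))) :
    (placementLaw N K F M).real {C | ∀ k, C k n ∈ G k} =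
      ∏ k, (subsetLaw F (cachedBits N F M)).real (G k) := by
  have := isProbabilityMeasure_subsetLaw (cachedBits_le (F := F) hN hM)
  have hset : {C : Placement N K F | ∀ k, C k n ∈ G k} =
      Set.univ.pi fun k => Function.eval n ⁻¹' G k := by
    ext C; simp
  rw [placementLaw_eq_pi, hset, Measure.real, Measure.pi_pi, ENNReal.toReal_prod]
  refine Finset.prod_congr rfl fun k _ => ?_
  rw [Measure.real, (measurePreserving_eval (fun _ : Fin N => subsetLaw F (cachedBits N F M))
    n).measure_preimage (Set.toFinite _).measurableSet.nullMeasurableSet]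

/-- The fraction of the bits of a file that are cached at exactly the users of a given set of `t`
users concentrates on `q ^ t * (1 - q) ^ (K - t)`, where `q` is the fraction of each file cached by
each user: any two distinct bits are at most as likely to be both such bits as if they were
independent, so that the variance of their number is at most `F`. -/
theorem placementLaw_real_exclusiveBits_ge_le {N K F : ℕ} (hN : 0 < N) {M : ℝ} (hM : M ≤ N)
    (d : Fin K → Fin N) (k : Fin K) (T : Finset (Fin K)) {x : ℝ} (hx : 0 < x) :
    (placementLaw N K F M).real {C | F * (((cachedBits N F M : ℝ) / F) ^ T.card *
        (1 - (cachedBits N F M : ℝ) / F) ^ (K - T.card)) + x ≤ (exclusiveBits C d k T).card} ≤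
      F / x ^ 2 := by
  classical
  have := isProbabilityMeasure_placementLaw (K := K) (F := F) hN hM
  have hc := cachedBits_le (F := F) hN hM
  set c := cachedBits N F M
  have hprod : ∀ a b : ℝ, (∏ j : Fin K, if j ∈ T then a else b) = a ^ T.card * b ^ (K - T.card) :=
    fun a b => by
      rw [Finset.prod_ite, Finset.prod_const, Finset.prod_const, Finset.filter_mem_eq_inter,
        Finset.univ_inter, Finset.filter_not, Finset.filter_mem_eq_inter, Finset.univ_inter,
        ← Finset.compl_eq_univ_sdiff, Finset.card_compl, Fintype.card_fin]
  let E : Fin F → Set (Placement N K F) := fun i => {C | ∀ j, i ∈ C j (d k) ↔ j ∈ T}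
  have hE : ∀ i, E i = {C | ∀ j, C j (d k) ∈ if j ∈ T then {A | i ∈ A} else {A | i ∉ A}} :=
    fun i => by
      ext C
      refine forall_congr' fun j => ?_
      split_ifs with h <;> simp [h]
  have hEE : ∀ i i', E i ∩ E i' = {C | ∀ j, C j (d k) ∈ if j ∈ T then {A | i ∈ A} ∩ {A | i' ∈ A}
      else {A | i ∉ A} ∩ {A | i' ∉ A}} := fun i i' => by
    ext C
    rw [hE, hE, Set.mem_inter_iff, Set.mem_ofPred_eq, Set.mem_ofPred_eq, ← forall_and]
    refine forall_congr' fun j => ?_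
    split_ifs <;> rfl
  refine le_trans (le_of_eq ?_) (measureReal_card_ge_le (placementLaw N K F M) E
    (fun i => (Set.toFinite _).measurableSet)
    (((c : ℝ) / F) ^ T.card * (1 - (c : ℝ) / F) ^ (K - T.card)) (fun i => ?_)
    (fun i i' hi => ?_) hx)
  · congr 1
    ext C
    simp only [Set.mem_ofPred_eq, exclusiveBits, E]
  · rw [hE, placementLaw_real_forall_mem hN hM, ← hprod]
    refine Finset.prod_congr rfl fun j _ => ?_
    split_ifs
    · exact subsetLaw_real_mem hc i
    · exact subsetLaw_real_notMem hc i
  · rw [hEE, placementLaw_real_forall_mem hN hM, ← hprod, ← Finset.prod_pow]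
    refine Finset.prod_le_prod (fun j _ => measureReal_nonneg) fun j _ => ?_
    split_ifs
    · exact subsetLaw_real_mem_mem_le hc hi
    · exact subsetLaw_real_notMem_notMem_le hc hi

/-! ### Random linear combinations -/

/-- A uniformly random vector is orthogonal to a nonzero vector with probability `1 / 2`: flipping a
coordinate in the support of the latter exchanges the two values of the product. -/
theorem uniformOn_orthogonal_le {F : ℕ} {x : BitString F} (hx : x ≠ 0) :
    uniformOn (Set.univ : Set (BitString F)) {v | ∑ i, v i * x i = 0} ≤ 2⁻¹ := by
  classical
  obtain ⟨i₀, hi₀⟩ := Function.ne_iff.1 hx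
  have hi : x i₀ = 1 := Fin.eq_one_of_ne_zero (x i₀) hi₀
  set A : Finset (BitString F) := Finset.univ.filter fun v => ∑ i, v i * x i = 0
  have hA : ({v | ∑ i, v i * x i = 0} : Set (BitString F)) = A := by ext v; simp [A]
  have hcard : A.card ≤ Aᶜ.card := by
    refine Finset.card_le_card_of_injOn (fun v => v + Pi.single i₀ 1) (fun v hv => ?_)
      fun v _ w _ h => add_right_cancel h
    have hv' : ∑ i, v i * x i = 0 := by simpa [A] using hv
    have : ∑ i, (v i + (Pi.single i₀ 1 : BitString F) i) * x i = 1 := by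
      simp [add_mul, Finset.sum_add_distrib, hv', Pi.single_apply, hi]
    simp [A, this]
  have hsum := Finset.card_add_card_compl A
  rw [hA, uniformOn_univ, Measure.count_apply_finset]
  rw [ENNReal.div_le_iff (by simp) (by simp), ← ENNReal.div_eq_inv_mul,
    ENNReal.le_div_iff_mul_le (by simp) (by simp)]
  have : A.card * 2 ≤ Fintype.card (BitString F) := by omega
  exact_mod_cast this

instance isProbabilityMeasure_coefficientsLaw (N F : ℕ) :
    IsProbabilityMeasure (coefficientsLaw N F) := by
  have : IsProbabilityMeasure (uniformOn (Set.univ : Set (BitString F))) :=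
    isProbabilityMeasure_uniformOn Set.finite_univ Set.univ_nonempty
  unfold coefficientsLaw
  infer_instance

theorem coefficientsLaw_forall_orthogonal_le {N F : ℕ} (n : Fin N) (l : ℕ) {x : BitString F}
    (hx : x ≠ 0) :
    coefficientsLaw N F {a | ∀ j < l, ∑ i, a (n, j) i * x i = 0} ≤ 2⁻¹ ^ l := by
  classical
  have : IsProbabilityMeasure (uniformOn (Set.univ : Set (BitString F))) :=
    isProbabilityMeasure_uniformOn Set.finite_univ Set.univ_nonempty
  have hset : {a : Coefficients N F | ∀ j < l, ∑ i, a (n, j) i * x i = 0} =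
      Set.pi (((Finset.range l).image fun j => (n, j) : Finset (Fin N × ℕ)) : Set (Fin N × ℕ))
        fun _ => {v | ∑ i, v i * x i = 0} := by
    ext a
    simp [Set.mem_pi]
  rw [hset, coefficientsLaw, Measure.infinitePi_pi _ fun _ _ => (Set.toFinite _).measurableSet,
    Finset.prod_const, Finset.card_image_of_injective _ (Prod.mk_right_injective n),
    Finset.card_range]
  exact pow_le_pow_left' (uniformOn_orthogonal_le hx) l

theorem exists_ne_zero_of_not_decodable {F : ℕ} {A : Finset (Fin F)} {a : ℕ → BitString F} {l : ℕ}
    (h : ¬ Decodable A a l) :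
    ∃ x : BitString F, x ≠ 0 ∧ (∀ i ∈ A, x i = 0) ∧ ∀ j < l, ∑ i, a j i * x i = 0 := by
  simp only [Decodable, not_forall] at h
  obtain ⟨w, w', hA, hl, hne⟩ := h
  refine ⟨w - w', sub_ne_zero.2 hne, fun i hi => by simp [hA i hi], fun j hj => ?_⟩
  simp [mul_sub, Finset.sum_sub_distrib, hl j hj]

theorem card_bitString_vanishing {F : ℕ} (A : Finset (Fin F)) :
    (Finset.univ.filter fun x : BitString F => ∀ i ∈ A, x i = 0).card = 2 ^ (F - A.card) := by
  classical
  have : (Finset.univ.filter fun x : BitString F => ∀ i ∈ A, x i = 0) =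
      Fintype.piFinset fun i => if i ∈ A then {0} else Finset.univ := by
    ext x
    simp only [Finset.mem_filter, Finset.mem_univ, true_and, Fintype.mem_piFinset]
    refine forall_congr' fun i => ?_
    split_ifs with h <;> simp [h]
  rw [this, Fintype.card_piFinset]
  have h2 : ∀ i, (if i ∈ A then {0} else Finset.univ : Finset (ZMod 2)).card =
      if i ∈ A then 1 else 2 := fun i => by split_ifs <;> simp
  simp_rw [h2]
  rw [Finset.prod_ite, Finset.prod_const_one, one_mul, Finset.prod_const, Finset.filter_not,
    Finset.filter_mem_eq_inter, Finset.univ_inter, ← Finset.compl_eq_univ_sdiff, Finset.card_compl,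
    Fintype.card_fin]

/-- Union bound over the nonzero strings that vanish on the cached bits. -/
theorem coefficientsLaw_not_decodable_le {N F : ℕ} (n : Fin N) (A : Finset (Fin F)) (e : ℕ) :
    coefficientsLaw N F {a | ¬ Decodable A (fun j => a (n, j)) (F - A.card + e)} ≤ 2⁻¹ ^ e := by
  classical
  set V := (Finset.univ.filter fun x : BitString F => ∀ i ∈ A, x i = 0)
  calc _ ≤ coefficientsLaw N F (⋃ x ∈ V.erase 0,
        {a | ∀ j < F - A.card + e, ∑ i, a (n, j) i * x i = 0}) := by
        refine measure_mono fun a ha => ?_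
        obtain ⟨x, hx0, hxA, hx⟩ := exists_ne_zero_of_not_decodable ha
        refine Set.mem_biUnion (x := x) ?_ hx
        simpa [V, hx0] using hxA
    _ ≤ ∑ x ∈ V.erase 0, coefficientsLaw N F
        {a | ∀ j < F - A.card + e, ∑ i, a (n, j) i * x i = 0} := measure_biUnion_finset_le _ _
    _ ≤ ∑ x ∈ V.erase 0, 2⁻¹ ^ (F - A.card + e) := Finset.sum_le_sum fun x hx =>
        coefficientsLaw_forall_orthogonal_le n _ (Finset.ne_of_mem_erase hx)
    _ ≤ V.card * 2⁻¹ ^ (F - A.card + e) := by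
        rw [Finset.sum_const, nsmul_eq_mul]
        gcongr
        exact Finset.erase_subset _ _
    _ = 2⁻¹ ^ e := by
        rw [card_bitString_vanishing, pow_add, ← mul_assoc]
        push_cast
        rw [← mul_pow, ENNReal.mul_inv_cancel (by simp) (by simp), one_pow, one_mul]

/-! ### The lengths of the two delivery procedures -/

/-- The limit, as the file size tends to infinity, of the length of the first delivery procedure
relative to the file size, when each user caches the fraction `q` of each file. -/
noncomputable def codedRate (K : ℕ) (q : ℝ) : ℝ :=
  ∑ S : Finset (Fin K) with S.Nonempty, q ^ (S.card - 1) * (1 - q) ^ (K - (S.card - 1))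

theorem continuous_codedRate (K : ℕ) : Continuous (codedRate K) := by
  unfold codedRate
  fun_prop

theorem codedRate_nonneg {K : ℕ} {q : ℝ} (h0 : 0 ≤ q) (h1 : q ≤ 1) : 0 ≤ codedRate K q :=
  Finset.sum_nonneg fun _ _ => mul_nonneg (pow_nonneg h0 _) (pow_nonneg (by linarith) _)

theorem codedRate_zero (K : ℕ) : codedRate K 0 = K := by
  classical
  have h : ∀ S ∈ (Finset.univ.filter fun S : Finset (Fin K) => S.Nonempty),
      (0 : ℝ) ^ (S.card - 1) * (1 - 0) ^ (K - (S.card - 1)) = if S.card = 1 then 1 else 0 := by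
    intro S hS
    have : 0 < S.card := Finset.card_pos.2 (Finset.mem_filter.1 hS).2
    split_ifs with h1
    · simp [h1]
    · rw [zero_pow (by omega), zero_mul]
  rw [codedRate, Finset.sum_congr rfl h, Finset.sum_boole, Finset.filter_filter]
  have : (Finset.univ.filter fun S : Finset (Fin K) => S.Nonempty ∧ S.card = 1) =
      Finset.univ.powersetCard 1 := by
    ext S
    simp only [Finset.mem_filter, Finset.mem_univ, true_and, Finset.mem_powersetCard,
      Finset.subset_univ, and_iff_right_iff_imp]
    exact fun h => Finset.card_pos.1 (by omega)
  rw [this]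
  simp

/-- The binomial theorem, with the term of the empty set removed. Multiplying by `q` avoids a
division by zero when nothing is cached. -/
theorem mul_codedRate (K : ℕ) (q : ℝ) : q * codedRate K q = (1 - q) * (1 - (1 - q) ^ K) := by
  classical
  have hbin := Finset.sum_pow_mul_eq_add_pow q (1 - q) (Finset.univ : Finset (Fin K))
  rw [Finset.powerset_univ, Finset.card_univ, Fintype.card_fin, add_sub_cancel, one_pow,
    ← Finset.sum_filter_add_sum_filter_not _ (fun S => S.Nonempty)] at hbin
  have hempty : (Finset.univ.filter fun S : Finset (Fin K) => ¬ S.Nonempty) = {∅} := by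
    ext S; simp
  rw [hempty, Finset.sum_singleton] at hbin
  have : q * codedRate K q = (1 - q) * ∑ S : Finset (Fin K) with S.Nonempty,
      q ^ S.card * (1 - q) ^ (K - S.card) := by
    rw [codedRate, Finset.mul_sum, Finset.mul_sum]
    refine Finset.sum_congr rfl fun S hS => ?_
    have h1 : 0 < S.card := Finset.card_pos.2 (Finset.mem_filter.1 hS).2
    have h2 : S.card ≤ K := by simpa using Finset.card_le_univ S
    obtain ⟨m, hm⟩ : ∃ m, S.card = m + 1 := ⟨S.card - 1, by omega⟩
    rw [hm, Nat.add_sub_cancel, show K - m = K - (m + 1) + 1 by omega, pow_succ, pow_succ]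
    ring
  rw [this]
  congr 1
  simp only [Finset.card_empty, pow_zero, one_mul, Nat.sub_zero] at hbin
  linarith

/-- The closed-form rate is the smaller of the limiting relative lengths of the two procedures. -/
theorem min_codedRate_eq {N K : ℕ} (hN : 0 < N) (hK : 0 < K) {M : ℝ} (hM0 : 0 ≤ M)
    (hMN : M ≤ N) : min (codedRate K (M / N)) (N - M) = decentralizedRateFormula N K M := by
  have hN' : (0 : ℝ) < N := by exact_mod_cast hN
  have hK' : (0 : ℝ) < K := by exact_mod_cast hK
  rcases hM0.eq_or_lt with rfl | hM
  · rw [zero_div, codedRate_zero, sub_zero, decentralizedRateFormula, if_pos rfl, min_comm]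
  · have hq1 : M / N ≤ 1 := (div_le_one hN').2 hMN
    rw [decentralizedRateFormula, if_neg hM.ne',
      mul_min_of_nonneg _ _ (mul_nonneg hK'.le (sub_nonneg.2 hq1))]
    congr 1
    · have h := mul_codedRate K (M / N)
      have hq : (M / N : ℝ) ≠ 0 := by positivity
      rw [mul_comm, ← eq_div_iff hq] at h
      rw [h]
      field_simp
    · field_simp

/-- If no string is longer than its typical length by more than `y`, the first procedure sends at
most `2 ^ K * y` bits more than is typical, as it sends one message for each set of users. -/
theorem deliveryLength₁_le {N K F : ℕ} (C : Placement N K F) (d : Fin K → Fin N) {q y : ℝ}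
    (hy : 0 ≤ y)
    (h : ∀ k (T : Finset (Fin K)), ((exclusiveBits C d k T).card : ℝ) ≤
      F * (q ^ T.card * (1 - q) ^ (K - T.card)) + y) :
    (deliveryLength₁ C d : ℝ) ≤ F * codedRate K q + 2 ^ K * y := by
  classical
  have hterm : ∀ S ∈ (Finset.univ.filter fun S : Finset (Fin K) => S.Nonempty),
      ((S.sup fun k => (exclusiveBits C d k (S \ {k})).card : ℕ) : ℝ) ≤
      F * (q ^ (S.card - 1) * (1 - q) ^ (K - (S.card - 1))) + y := by
    intro S hS
    obtain ⟨k, hk, hsup⟩ := Finset.exists_mem_eq_sup S (Finset.mem_filter.1 hS).2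
      fun k => (exclusiveBits C d k (S \ {k})).card
    rw [hsup]
    have hcard : (S \ {k}).card = S.card - 1 := by
      rw [Finset.sdiff_singleton_eq_erase, Finset.card_erase_of_mem hk]
    rw [← hcard]
    exact h k _
  calc (deliveryLength₁ C d : ℝ) ≤ ∑ S : Finset (Fin K) with S.Nonempty,
        (F * (q ^ (S.card - 1) * (1 - q) ^ (K - (S.card - 1))) + y) := by
        rw [deliveryLength₁]
        push_cast
        exact Finset.sum_le_sum hterm
    _ = F * codedRate K q +
        (Finset.univ.filter fun S : Finset (Fin K) => S.Nonempty).card * y := by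
        rw [Finset.sum_add_distrib, ← Finset.mul_sum, Finset.sum_const, nsmul_eq_mul, codedRate]
    _ ≤ F * codedRate K q + 2 ^ K * y := by
        gcongr
        have := Finset.card_filter_le (Finset.univ : Finset (Finset (Fin K))) fun S => S.Nonempty
        rw [Finset.card_univ, Fintype.card_finset, Fintype.card_fin] at this
        exact_mod_cast this

theorem deliveryLength₂_le {N K F : ℕ} (C : Placement N K F) (a : Coefficients N F)
    (d : Fin K → Fin N) (l : ℕ) (h : ∀ k n, Decodable (C k n) (fun j => a (n, j)) l) :
    deliveryLength₂ C a d ≤ (N * l : ℕ) := by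
  calc deliveryLength₂ C a d ≤ ∑ _n : Fin N, (l : ℕ∞) :=
        Finset.sum_le_sum fun n _ => iInf₂_le l fun k _ => h k n
    _ = (N * l : ℕ) := by simp

/-! ### The rate of the decentralized algorithm -/

theorem tendsto_measure_one {Ω : ℕ → Type*} [∀ F, MeasurableSpace (Ω F)]
    (μ : ∀ F, Measure (Ω F)) [∀ F, IsProbabilityMeasure (μ F)] (G : ∀ F, Set (Ω F))
    (β : ℕ → ℝ≥0∞) (hβ : Tendsto β atTop (𝓝 0)) (h : ∀ᶠ F in atTop, μ F (G F)ᶜ ≤ β F) :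
    Tendsto (fun F => μ F (G F)) atTop (𝓝 1) := by
  have h1 : Tendsto (fun F => 1 - β F) atTop (𝓝 1) := by
    simpa using ENNReal.Tendsto.sub (tendsto_const_nhds (x := (1 : ℝ≥0∞))) hβ (by simp)
  refine tendsto_of_tendsto_of_tendsto_of_le_of_le' h1 tendsto_const_nhds ?_
    (Eventually.of_forall fun F => prob_le_one)
  filter_upwards [h] with F hF
  rw [tsub_le_iff_right]
  calc 1 = μ F (G F ∪ (G F)ᶜ) := by rw [Set.union_compl_self, measure_univ]
    _ ≤ μ F (G F) + μ F (G F)ᶜ := measure_union_le _ _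
    _ ≤ μ F (G F) + β F := by gcongr

/-- A bound on all sections over points of positive mass bounds the whole set, which need not be
measurable. -/
theorem measure_prod_le_of_forall {Ω Ω' : Type*} [Fintype Ω] [MeasurableSpace Ω]
    [MeasurableSingletonClass Ω] [MeasurableSpace Ω'] (μ : Measure Ω) [IsProbabilityMeasure μ]
    (ν : Measure Ω') [SFinite ν] (B : Ω → Set Ω') (β : ℝ≥0∞)
    (h : ∀ x, μ {x} ≠ 0 → ν (B x) ≤ β) :
    (μ.prod ν) {ω | ω.2 ∈ B ω.1} ≤ β := by
  calc (μ.prod ν) {ω | ω.2 ∈ B ω.1} ≤ (μ.prod ν) (⋃ x, {x} ×ˢ B x) := by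
        refine measure_mono fun ω hω => Set.mem_iUnion.2 ⟨ω.1, rfl, hω⟩
    _ ≤ ∑ x, (μ.prod ν) ({x} ×ˢ B x) := measure_iUnion_fintype_le _ _
    _ ≤ ∑ x, μ {x} * β := Finset.sum_le_sum fun x _ => by
        rw [Measure.prod_prod]
        by_cases hx : μ {x} = 0
        · simp [hx]
        · gcongr
          exact h x hx
    _ = β := by
        rw [← Finset.sum_mul, sum_measure_singleton]
        simp

theorem tendsto_cachedBits_div {N : ℕ} {M : ℝ} (hM : 0 ≤ M) :
    Tendsto (fun F : ℕ => (cachedBits N F M : ℝ) / F) atTop (𝓝 (M / N)) := by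
  have := (tendsto_nat_floor_mul_div_atTop (R := ℝ) (a := M / N) (by positivity)).comp
    (tendsto_natCast_atTop_atTop (R := ℝ))
  refine this.congr fun F => ?_
  simp only [Function.comp_apply, cachedBits, div_mul_eq_mul_div]

/-- The first procedure: each of the finitely many string lengths exceeds its expectation by `δ F`
with probability at most `1 / (δ ^ 2 F)`, so that with high probability none does. -/
theorem tendsto_bitsSent_of_codedRate_lt {N K : ℕ} (hN : 0 < N) {M R : ℝ} (hM0 : 0 ≤ M)
    (hMN : M ≤ N) (hR : codedRate K (M / N) < R) (d : Fin K → Fin N) :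
    Tendsto (fun F : ℕ => ((placementLaw N K F M).prod (coefficientsLaw N F))
      {ω | bitsSent ω d ≤ (⌊R * F⌋₊ : ℕ∞)}) atTop (𝓝 1) := by
  have hμ := fun F => isProbabilityMeasure_placementLaw (K := K) (F := F) hN hMN
  set η : ℝ := (R - codedRate K (M / N)) / 2 with hη
  have hη0 : 0 < η := by linarith
  set δ : ℝ := η / 2 ^ K with hδ
  have hδ0 : 0 < δ := by positivity
  have hrate : ∀ᶠ F : ℕ in atTop, codedRate K ((cachedBits N F M : ℝ) / F) < R - η :=
    ((continuous_codedRate K).continuousAt.tendsto.comp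
      (tendsto_cachedBits_div (N := N) hM0)).eventually (gt_mem_nhds (by linarith))
  have hβ : Tendsto (fun F : ℕ => ∑ _i : Fin K × Finset (Fin K),
      ENNReal.ofReal ((δ ^ 2)⁻¹ * (F : ℝ)⁻¹)) atTop (𝓝 0) := by
    have h1 : Tendsto (fun F : ℕ => (δ ^ 2)⁻¹ * (F : ℝ)⁻¹) atTop (𝓝 0) := by
      simpa using (tendsto_inv_atTop_nhds_zero_nat (𝕜 := ℝ)).const_mul (δ ^ 2)⁻¹
    simpa using tendsto_finsetSum Finset.univ
      fun (_ : Fin K × Finset (Fin K)) _ => ENNReal.tendsto_ofReal h1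
  refine tendsto_measure_one _ _ _ hβ ?_
  filter_upwards [hrate, eventually_gt_atTop 0] with F hF hF0
  have hF0' : (0 : ℝ) < F := by exact_mod_cast hF0
  set q : ℝ := (cachedBits N F M : ℝ) / F with hq
  let B : Fin K × Finset (Fin K) → Set (Placement N K F) := fun i =>
    {C | F * (q ^ i.2.card * (1 - q) ^ (K - i.2.card)) + δ * F ≤ (exclusiveBits C d i.1 i.2).card}
  have hsub : {ω : Placement N K F × Coefficients N F | bitsSent ω d ≤ (⌊R * F⌋₊ : ℕ∞)}ᶜ ⊆
      (⋃ i, B i) ×ˢ Set.univ := by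
    intro ω hω
    refine ⟨?_, trivial⟩
    by_contra hB
    refine hω (Set.mem_ofPred.2 (le_trans (min_le_left _ _) ?_))
    have hlen : (deliveryLength₁ ω.1 d : ℝ) ≤ F * codedRate K q + 2 ^ K * (δ * F) := by
      refine deliveryLength₁_le ω.1 d (by positivity) fun k T => ?_
      have : ω.1 ∉ B (k, T) := fun h => hB (Set.mem_iUnion.2 ⟨_, h⟩)
      exact (not_le.1 this).le
    have hδη : 2 ^ K * (δ * F) = η * F := by rw [hδ]; field_simp
    refine Nat.cast_le.2 (Nat.le_floor ?_)
    nlinarith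
  calc _ ≤ ((placementLaw N K F M).prod (coefficientsLaw N F)) ((⋃ i, B i) ×ˢ Set.univ) :=
        measure_mono hsub
    _ = placementLaw N K F M (⋃ i, B i) := by
        rw [Measure.prod_prod, measure_univ, mul_one]
    _ ≤ ∑ i, placementLaw N K F M (B i) := measure_iUnion_fintype_le _ _
    _ ≤ _ := Finset.sum_le_sum fun i _ => by
        rw [← ofReal_measureReal]
        refine ENNReal.ofReal_le_ofReal
          ((placementLaw_real_exclusiveBits_ge_le hN hMN d i.1 i.2 (by positivity)).trans
            (le_of_eq ?_))
        field_simp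

theorem card_eq_of_placementLaw_ne_zero {N K F : ℕ} {M : ℝ} {C : Placement N K F}
    (h : placementLaw N K F M {C} ≠ 0) (k : Fin K) (n : Fin N) :
    (C k n).card = cachedBits N F M := by
  rw [placementLaw, Ne, uniformOn_eq_zero_iff (Set.toFinite _), ← Ne,
    ← Set.nonempty_iff_ne_empty, Set.inter_singleton_nonempty] at h
  exact h k n

/-- The second procedure: `F - c + η F` combinations of each file suffice with high probability,
where `c` is the number of bits of the file that each user caches. -/
theorem tendsto_bitsSent_of_sub_lt {N K : ℕ} (hN : 0 < N) {M R : ℝ} (hM0 : 0 ≤ M)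
    (hMN : M ≤ N) (hR : N - M < R) (d : Fin K → Fin N) :
    Tendsto (fun F : ℕ => ((placementLaw N K F M).prod (coefficientsLaw N F))
      {ω | bitsSent ω d ≤ (⌊R * F⌋₊ : ℕ∞)}) atTop (𝓝 1) := by
  have hN' : (0 : ℝ) < N := by exact_mod_cast hN
  have hμ := fun F => isProbabilityMeasure_placementLaw (K := K) (F := F) hN hMN
  set η : ℝ := (R - (N - M)) / 2 / N with hη
  have hηN : N * η = (R - (N - M)) / 2 := by rw [hη]; field_simp
  have hη0 : 0 < η := div_pos (by linarith) hN'
  have hrate : ∀ᶠ F : ℕ in atTop, N - N * ((cachedBits N F M : ℝ) / F) < R - N * η := by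
    refine (((tendsto_cachedBits_div (N := N) hM0).const_mul (N : ℝ)).const_sub
      (N : ℝ)).eventually (gt_mem_nhds ?_)
    rw [mul_div_cancel₀ _ hN'.ne']
    linarith
  have hβ : Tendsto (fun F : ℕ => ∑ _i : Fin K × Fin N, (2⁻¹ : ℝ≥0∞) ^ ⌊η * F⌋₊) atTop (𝓝 0) := by
    have h1 : Tendsto (fun F : ℕ => ⌊η * F⌋₊) atTop atTop :=
      tendsto_nat_floor_atTop.comp (tendsto_natCast_atTop_atTop.const_mul_atTop hη0)
    have h2 := (ENNReal.tendsto_pow_atTop_nhds_zero_of_lt_one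
      (r := 2⁻¹) (ENNReal.inv_lt_one.2 (by norm_num))).comp h1
    simpa using tendsto_finsetSum Finset.univ fun (_ : Fin K × Fin N) _ => h2
  refine tendsto_measure_one _ _ _ hβ ?_
  filter_upwards [hrate, eventually_gt_atTop 0] with F hF hF0
  have hF0' : (0 : ℝ) < F := by exact_mod_cast hF0
  have hc := cachedBits_le (F := F) hN hMN
  set c := cachedBits N F M with hcdef
  set e := ⌊η * F⌋₊ with he
  have heF : (e : ℝ) ≤ η * F := Nat.floor_le (by positivity)
  let B : Placement N K F → Set (Coefficients N F) := fun C =>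
    ⋃ i : Fin K × Fin N, {a | ¬ Decodable (C i.1 i.2) (fun j => a (i.2, j)) (F - c + e)}
  have hlen : N * (F - c + e) ≤ ⌊R * F⌋₊ := by
    refine Nat.le_floor ?_
    push_cast [Nat.cast_sub hc]
    have h1 : (N - N * ((c : ℝ) / F)) * F = N * (F - c) := by field_simp
    nlinarith
  have hsub : {ω : Placement N K F × Coefficients N F | bitsSent ω d ≤ (⌊R * F⌋₊ : ℕ∞)}ᶜ ⊆
      {ω | ω.2 ∈ B ω.1} := by
    intro ω hω
    by_contra hB
    refine hω (Set.mem_ofPred.2 (le_trans (min_le_right _ _)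
      ((deliveryLength₂_le ω.1 ω.2 d (F - c + e) fun k n => ?_).trans (Nat.cast_le.2 hlen))))
    by_contra hdec
    exact hB (Set.mem_iUnion.2 ⟨(k, n), hdec⟩)
  refine (measure_mono hsub).trans (measure_prod_le_of_forall _ _ B _ fun C hC => ?_)
  refine (measure_iUnion_fintype_le _ _).trans (Finset.sum_le_sum fun i _ => ?_)
  have := coefficientsLaw_not_decodable_le i.2 (C i.1 i.2) e
  rwa [card_eq_of_placementLaw_ne_zero hC] at this

theorem decentralizedRate_le_formula {N K : ℕ} (hN : 0 < N) (hK : 0 < K) {M : ℝ} (hM0 : 0 ≤ M)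
    (hMN : M ≤ N) : decentralizedRate N K M ≤ decentralizedRateFormula N K M := by
  have hN' : (0 : ℝ) < N := by exact_mod_cast hN
  rw [← min_codedRate_eq hN hK hM0 hMN]
  refine le_of_forall_gt fun R hR => ?_
  obtain ⟨R', hR', hR'R⟩ := exists_between hR
  refine lt_of_le_of_lt (csInf_le ⟨0, fun x hx => hx.1⟩ ⟨?_, fun d => ?_⟩) hR'R
  · refine le_trans (le_min (codedRate_nonneg (by positivity) ?_) (by linarith)) hR'.le
    exact (div_le_one hN').2 hMN
  · rcases min_lt_iff.1 hR' with h | h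
    · exact tendsto_bitsSent_of_codedRate_lt hN hM0 hMN h d
    · exact tendsto_bitsSent_of_sub_lt hN hM0 hMN h d

end CodedCaching

theorem theorem2 (N K : ℕ) (hN : 0 < N) (hK : 0 < K) (M : ℝ) (hM : M ∈ Set.Icc (0 : ℝ) N) :
    (CodedCaching.decentralizedRate N K M ≤ 12 * CodedCaching.optimalRate N K M ∧
      CodedCaching.decentralizedRateFormula N K M ≤ 12 * CodedCaching.optimalRate N K M) ∧
    (M < N →
      0 < CodedCaching.optimalRate N K M ∧
      CodedCaching.decentralizedRate N K M / CodedCaching.optimalRate N K M ≤ 12 ∧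
      CodedCaching.decentralizedRateFormula N K M / CodedCaching.optimalRate N K M ≤ 12) := by
  obtain ⟨hM0, hMN⟩ := hM
  have hformula := CodedCaching.decentralizedRateFormula_le_twelve_mul hN hK hM0 hMN
  have hrate := (CodedCaching.decentralizedRate_le_formula hN hK hM0 hMN).trans hformula
  refine ⟨⟨hrate, hformula⟩, fun hlt => ?_⟩
  have hN' : (0 : ℝ) < N := by exact_mod_cast hN
  have hpos : 0 < CodedCaching.optimalRate N K M :=
    lt_of_lt_of_le (sub_pos.2 ((div_lt_one hN').2 hlt))
      (CodedCaching.le_optimalRate fun R hR => hR.one_sub_le hN hK hM0)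
  exact ⟨hpos, (div_le_iff₀ hpos).2 hrate, (div_le_iff₀ hpos).2 hformula⟩
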